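/- Let $\zeta$ be the Riemann zeta function and let $B_n$ denote the Bernoulli numbers, defined by $\sum_{n\ge 0} B_n z^n/n! = z/(e^z-1)$ for $|z|<2\pi$. For every integer $m\ge 0$ the series below converges and $$\zeta(4m+3)-\frac{2}{1-2^{-4m-3}}\sum_{j=1}^{\infty}\frac{(2j-1)^{-4m-3}}{e^{(2j-1)\pi}+1}=-\frac{2^{4m+2}\pi^{4m+3}}{2^{4m+3}-1}\sum_{j=1}^{2m+1}\frac{(-1)^jB_{2j}B_{4m+4-2j}}{(2j)!\,(4m+4-2j)!}\,(2^{2j}-1)(2^{4m+4-2j}-1).$$ In particular, $$\zeta(3)-\frac{16}{7}\sum_{j=1}^{\infty}\frac{(2j-1)^{-3}}{e^{(2j-1)\pi}+1}=\frac{\pi^3}{28}.$$ -/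

import Mathlib

open Real

/-! Since `1 - 2 / (exp (x * π) + 1) = tanh (π * x / 2)`, the left side is, up to the factor `1 - 2
^ (-4m-3)`, the sum of `tanh (π * x / 2) / x ^ (4m+3)` over odd `x > 0`. Partial fractions
(`hasSum_tanh`) turn it into a double series of `1 / (a ^ (2m+1) * (a + b))` over odd squares `a`,
`b`. Adding its transpose gives a finite sum of products of single series
(`hasSum_of_hasSum_one_div_pow_mul_add`), which Euler's formula evaluates by Bernoulli numbers. -/

theorem HasSum.odd_of_even {f : ℕ → ℝ} {a b : ℝ} (h : HasSum f a)
    (he : HasSum (fun n => f (2 * n)) b) : HasSum (fun n => f (2 * n + 1)) (a - b) := by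
  have hinj : Function.Injective (fun n : ℕ => 2 * n + 1) := fun m n hmn => by
    simp only at hmn; omega
  have ho : Summable (fun n => f (2 * n + 1)) := h.summable.comp_injective hinj
  have : a = b + ∑' n, f (2 * n + 1) := h.unique (he.even_add_odd ho.hasSum)
  rw [this, add_sub_cancel_left]
  exact ho.hasSum

theorem hasSum_one_div_odd_pow {s : ℕ} {z : ℝ} (hz : HasSum (fun n : ℕ => 1 / (n : ℝ) ^ s) z) :
    HasSum (fun n : ℕ => 1 / (2 * (n : ℝ) + 1) ^ s) ((1 - 1 / 2 ^ s) * z) := by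
  have he : HasSum (fun n : ℕ => 1 / ((2 * n : ℕ) : ℝ) ^ s) (1 / 2 ^ s * z) := by
    refine (hz.mul_left (1 / 2 ^ s)).congr_fun fun n => ?_
    push_cast
    rw [mul_pow, one_div_mul_one_div]
  convert! hz.odd_of_even he using 1
  · ext n; push_cast; rfl
  · ring

/-- The cotangent expansion at `x * I`. The `n = 0` term is `2 / x`, which turns the usual `-1 / x`
into `+1 / x`. -/
theorem hasSum_coth {x : ℝ} (hx : 0 < x) :
    HasSum (fun n : ℕ => 2 * x / (x ^ 2 + (n : ℝ) ^ 2))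
      (π * ((1 + exp (-(2 * π * x))) / (1 - exp (-(2 * π * x)))) + 1 / x) := by
  have hz : (x : ℂ) * Complex.I ∈ Complex.integerComplement := by
    rintro ⟨n, hn⟩
    have := congrArg Complex.im hn
    simp at this
    exact hx.ne this
  have hs := (summable_cotTerm hz).hasSum
  have ht := cot_series_rep' hz
  have hterm : ∀ n : ℕ, cotTerm ((x : ℂ) * Complex.I) n =
      -Complex.I * ((2 * x / (x ^ 2 + ((n + 1 : ℕ) : ℝ) ^ 2) : ℝ) : ℂ) := by
    intro n
    rw [cotTerm_identity hz]
    have h0 : ((x : ℂ) ^ 2 + ((n : ℂ) + 1) ^ 2) ≠ 0 := by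
      have : x ^ 2 + ((n : ℝ) + 1) ^ 2 ≠ 0 := by positivity
      exact_mod_cast this
    have h1 : ((x : ℂ) * Complex.I + (n + 1)) * ((x : ℂ) * Complex.I - (n + 1)) =
        -((x : ℂ) ^ 2 + ((n : ℂ) + 1) ^ 2) := by
      linear_combination (x : ℂ) ^ 2 * Complex.I_sq
    rw [h1]
    push_cast
    field_simp
  have hval : ∑' n : ℕ, cotTerm ((x : ℂ) * Complex.I) n =
      -Complex.I * ((π * ((1 + exp (-(2 * π * x))) / (1 - exp (-(2 * π * x)))) - 1 / x : ℝ) : ℂ) := by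
    have he : Complex.exp (2 * π * Complex.I * (x * Complex.I)) = (exp (-(2 * π * x)) : ℝ) := by
      rw [Complex.ofReal_exp]
      congr 1
      push_cast
      linear_combination 2 * (π : ℂ) * x * Complex.I_sq
    unfold cotTerm
    rw [← ht, Complex.cot_pi_eq_exp_ratio, he]
    push_cast
    simp only [div_eq_mul_inv, mul_inv, Complex.inv_I]
    ring
  rw [hval, funext hterm] at hs
  have hI : -Complex.I ≠ 0 := by simp
  have hs' := Complex.hasSum_ofReal.mp ((hasSum_mul_left_iff hI).mp hs)
  rw [← hasSum_nat_add_iff' 1]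
  convert! hs' using 1
  simp
  field_simp
  ring

/-- The partial fraction expansion of `π * tanh (π * x / 2)`. -/
theorem hasSum_tanh {x : ℝ} (hx : 0 < x) :
    HasSum (fun n : ℕ => 4 * x / (x ^ 2 + (2 * (n : ℝ) + 1) ^ 2))
      (π * (1 - 2 / (exp (x * π) + 1))) := by
  -- With `y = π * x / 2`, this uses `2 coth (2y) - coth y = tanh y`; the `2 / x` terms cancel.
  have h1 := (hasSum_coth hx).mul_left 2
  have h2 := hasSum_coth (half_pos hx)
  have he : HasSum (fun n : ℕ => 2 * (2 * x / (x ^ 2 + ((2 * n : ℕ) : ℝ) ^ 2)))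
      (π * ((1 + exp (-(2 * π * (x / 2)))) / (1 - exp (-(2 * π * (x / 2))))) + 1 / (x / 2)) := by
    refine h2.congr_fun fun n => ?_
    push_cast
    field_simp
  convert! h1.odd_of_even he using 1
  · ext n; push_cast; ring
  · have hE : 1 < exp (x * π) := by
      rw [one_lt_exp_iff]
      have := pi_pos
      positivity
    have e1 : exp (-(2 * π * (x / 2))) = (exp (x * π))⁻¹ := by
      rw [← exp_neg]; congr 1; ring
    have e2 : exp (-(2 * π * x)) = ((exp (x * π)) ^ 2)⁻¹ := by
      rw [← exp_nat_mul, ← exp_neg]; congr 1; push_cast; ring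
    rw [e1, e2]
    set E := exp (x * π)
    have h3 : E - 1 ≠ 0 := by linarith
    have h4 : E + 1 ≠ 0 := by linarith
    have h5 : E ≠ 0 := by linarith
    have h6 : 1 - E⁻¹ ≠ 0 := by
      rw [show 1 - E⁻¹ = (E - 1) / E by field_simp]; positivity
    have h7 : 1 - (E ^ 2)⁻¹ = (E - 1) * (E + 1) / E ^ 2 := by field_simp; ring
    have h8 : 1 - E⁻¹ = (E - 1) / E := by field_simp
    rw [h7, h8]
    field_simp
    ring

/-- The exponent is odd, so `a + b` divides `a ^ (2m+1) + b ^ (2m+1)`, with an alternating geometric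
sum as quotient. -/
theorem one_div_pow_mul_add_symm {a b : ℝ} (ha : 0 < a) (hb : 0 < b) (m : ℕ) :
    1 / (a ^ (2 * m + 1) * (a + b)) + 1 / (b ^ (2 * m + 1) * (b + a)) =
      ∑ i ∈ Finset.range (2 * m + 1), (-1) ^ i * (1 / a ^ (i + 1) * (1 / b ^ (2 * m + 1 - i))) := by
  have key := geom_sum₂_mul a (-b) (2 * m + 1)
  rw [Odd.neg_pow ⟨m, rfl⟩, sub_neg_eq_add, sub_neg_eq_add] at key
  have hab : a + b ≠ 0 := by positivity
  have lhs : 1 / (a ^ (2 * m + 1) * (a + b)) + 1 / (b ^ (2 * m + 1) * (b + a)) =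
      (a ^ (2 * m + 1) + b ^ (2 * m + 1)) / (a + b) / (a ^ (2 * m + 1) * b ^ (2 * m + 1)) := by
    rw [add_comm b a]
    field_simp
    ring
  rw [lhs, ← key, mul_div_cancel_right₀ _ hab, Finset.sum_div, ← Finset.sum_range_reflect]
  refine Finset.sum_congr rfl fun i hi => ?_
  have hi' : i ≤ 2 * m := by have := Finset.mem_range.mp hi; omega
  obtain ⟨k, hk⟩ := Nat.exists_eq_add_of_le hi'
  rw [show 2 * m + 1 - 1 - i = k by omega, show 2 * m + 1 - 1 - k = i by omega,
    show 2 * m + 1 - i = k + 1 by omega, show 2 * m + 1 = i + k + 1 by omega, neg_pow b]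
  rw [show a ^ (i + k + 1) = a ^ k * a ^ (i + 1) by ring,
    show b ^ (i + k + 1) = b ^ i * b ^ (k + 1) by ring]
  field_simp

theorem hasSum_of_hasSum_one_div_pow_mul_add {u l r : ℕ → ℝ} (m : ℕ) (hu : ∀ n, 0 < u n)
    (hl : ∀ k, k ≠ 0 → HasSum (fun n => 1 / u n ^ k) (l k))
    (hr : ∀ n, HasSum (fun k => 1 / (u n ^ (2 * m + 1) * (u n + u k))) (r n)) :
    HasSum r
      (1 / 2 * ∑ i ∈ Finset.range (2 * m + 1), (-1) ^ i * (l (i + 1) * l (2 * m + 1 - i))) := by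
  have hnn : ∀ k n, 0 ≤ 1 / u n ^ k := fun k n => one_div_nonneg.mpr (pow_nonneg (hu n).le k)
  have hprod : ∀ j k, j ≠ 0 → k ≠ 0 →
      HasSum (fun p : ℕ × ℕ => 1 / u p.1 ^ j * (1 / u p.2 ^ k)) (l j * l k) := fun j k hj hk =>
    (hl j hj).mul (hl k hk) ((hl j hj).summable.mul_of_nonneg (hl k hk).summable (hnn j) (hnn k))
  -- Replacing `u p.1 + u p.2` by `u p.2` bounds the terms by a product series.
  have hF : Summable fun p : ℕ × ℕ => 1 / (u p.1 ^ (2 * m + 1) * (u p.1 + u p.2)) := by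
    refine Summable.of_nonneg_of_le (fun p => ?_) (fun p => ?_)
      (hprod (2 * m + 1) 1 (by omega) one_ne_zero).summable
    · have h1 := hu p.1
      have h2 := hu p.2
      positivity
    · have h1 := hu p.1
      have h2 := hu p.2
      rw [one_div_mul_one_div, pow_one]
      exact one_div_le_one_div_of_le (by positivity) (by gcongr; linarith)
  have hswap := (Equiv.prodComm ℕ ℕ).hasSum_iff.mpr hF.hasSum
  have hsymm : HasSum (fun p : ℕ × ℕ => 1 / (u p.1 ^ (2 * m + 1) * (u p.1 + u p.2)) +
      1 / (u p.2 ^ (2 * m + 1) * (u p.2 + u p.1)))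
      (∑ i ∈ Finset.range (2 * m + 1), (-1) ^ i * (l (i + 1) * l (2 * m + 1 - i))) := by
    simp only [one_div_pow_mul_add_symm (hu _) (hu _)]
    exact hasSum_sum fun i hi => (hprod (i + 1) (2 * m + 1 - i) i.succ_ne_zero
      (by have := Finset.mem_range.mp hi; omega)).mul_left _
  have hT := (hF.hasSum.add hswap).unique hsymm
  rw [← hT, ← two_mul, ← mul_assoc, one_div_mul_cancel two_ne_zero, one_mul]
  exact hF.hasSum.prod_fiberwise hr

theorem hasSum_tanh_div_odd_pow (m : ℕ) {l : ℕ → ℝ}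
    (hl : ∀ k, k ≠ 0 → HasSum (fun n : ℕ => 1 / (2 * (n : ℝ) + 1) ^ (2 * k)) (l k)) :
    HasSum (fun n : ℕ => (1 - 2 / (exp ((2 * (n : ℝ) + 1) * π) + 1)) /
        (2 * (n : ℝ) + 1) ^ (4 * m + 3))
      (2 / π * ∑ i ∈ Finset.range (2 * m + 1), (-1) ^ i * (l (i + 1) * l (2 * m + 1 - i))) := by
  -- Each row is the tanh expansion at `x = 2n + 1`, divided by `4 * x ^ (4m+3)`.
  have hrow : ∀ n : ℕ, HasSum (fun k : ℕ => 1 / (((2 * (n : ℝ) + 1) ^ 2) ^ (2 * m + 1) *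
      ((2 * (n : ℝ) + 1) ^ 2 + (2 * (k : ℝ) + 1) ^ 2)))
      (π / 4 * ((1 - 2 / (exp ((2 * (n : ℝ) + 1) * π) + 1)) / (2 * (n : ℝ) + 1) ^ (4 * m + 3))) := by
    intro n
    have hx : 0 < 2 * (n : ℝ) + 1 := by positivity
    convert! (hasSum_tanh hx).mul_left (1 / (4 * (2 * (n : ℝ) + 1) ^ (4 * m + 3))) using 1
    · ext k
      have h1 : (0 : ℝ) < (2 * (n : ℝ) + 1) ^ 2 + (2 * (k : ℝ) + 1) ^ 2 := by positivity
      rw [← pow_mul, show 4 * m + 3 = 2 * (2 * m + 1) + 1 by ring, pow_succ]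
      field_simp
      ring
    · field_simp
  have := (hasSum_of_hasSum_one_div_pow_mul_add (u := fun n : ℕ => (2 * (n : ℝ) + 1) ^ 2) m
    (fun n => by positivity) (fun k hk => by simpa only [pow_mul] using hl k hk)
    hrow).mul_left (4 / π)
  convert! this using 1
  · ext n
    rw [← mul_assoc, div_mul_div_cancel₀' (by norm_num), div_self pi_ne_zero, one_mul]
  · ring

theorem hasSum_one_div_odd_pow_even {k : ℕ} (hk : k ≠ 0) :
    HasSum (fun n : ℕ => 1 / (2 * (n : ℝ) + 1) ^ (2 * k))
      ((-1) ^ (k + 1) * (2 ^ (2 * k) - 1) * π ^ (2 * k) * bernoulli (2 * k) /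
        (2 * (2 * k).factorial)) := by
  convert! hasSum_one_div_odd_pow (hasSum_zeta_nat hk) using 1
  obtain ⟨j, rfl⟩ := Nat.exists_eq_succ_of_ne_zero hk
  rw [show 2 * (j + 1) - 1 = 2 * j + 1 by omega, show 2 * (j + 1) = 2 * j + 1 + 1 by ring,
    pow_succ (2 : ℝ) (2 * j + 1)]
  field_simp

theorem hasSum_tanh_div_odd_pow_bernoulli (m : ℕ) :
    HasSum (fun n : ℕ => (1 - 2 / (exp ((2 * (n : ℝ) + 1) * π) + 1)) /
        (2 * (n : ℝ) + 1) ^ (4 * m + 3))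
      (-(π ^ (4 * m + 3) / 2) * ∑ j ∈ Finset.Icc 1 (2 * m + 1),
        (-1 : ℝ) ^ j * (bernoulli (2 * j) : ℝ) * (bernoulli (4 * m + 4 - 2 * j) : ℝ) /
            ((Nat.factorial (2 * j) : ℝ) * (Nat.factorial (4 * m + 4 - 2 * j) : ℝ)) *
          ((2 : ℝ) ^ (2 * j) - 1) * ((2 : ℝ) ^ (4 * m + 4 - 2 * j) - 1)) := by
  convert! hasSum_tanh_div_odd_pow m fun k hk => hasSum_one_div_odd_pow_even hk using 1
  rw [← Finset.Ico_add_one_right_eq_Icc, Finset.sum_Ico_eq_sum_range, Nat.add_sub_cancel,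
    Finset.mul_sum, Finset.mul_sum]
  refine Finset.sum_congr rfl fun i hi => ?_
  obtain ⟨k, hk⟩ := Nat.exists_eq_add_of_le (Nat.lt_succ_iff.mp (Finset.mem_range.mp hi))
  have hpi : π ^ (4 * m + 3) = π ^ (2 * (i + 1)) * π ^ (2 * (k + 1)) / π := by
    rw [← pow_add, eq_div_iff pi_ne_zero, ← pow_succ]
    congr 1
    omega
  -- As `i + k = 2m`, the two indices have the same parity.
  have hsign : (-1 : ℝ) ^ (k + 1 + 1) = (-1) ^ i := by
    rw [neg_one_pow_eq_pow_mod_two, neg_one_pow_eq_pow_mod_two (n := i)]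
    congr 1
    omega
  rw [hpi, show 2 * m + 1 - i = k + 1 by omega, show 4 * m + 4 - 2 * (1 + i) = 2 * (k + 1) by omega,
    add_comm 1 i, hsign]
  have h1 : (-1 : ℝ) ^ i * (-1) ^ i = 1 := by rw [← mul_pow]; simp
  field_simp
  rw [sq, h1]
  ring

theorem summable_odd_pow_div_exp (s : ℕ) :
    Summable fun n : ℕ => 1 / (2 * (n : ℝ) + 1) ^ s / (exp ((2 * (n : ℝ) + 1) * π) + 1) := by
  have hg : Summable fun n : ℕ => exp (-1) ^ n :=
    summable_geometric_of_lt_one (exp_pos _).le (by rw [exp_lt_one_iff]; norm_num)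
  refine Summable.of_nonneg_of_le (fun n => by positivity) (fun n => ?_) hg
  have h1 : (1 : ℝ) ≤ (2 * (n : ℝ) + 1) ^ s :=
    one_le_pow₀ (by have : (0 : ℝ) ≤ n := n.cast_nonneg
                    linarith)
  have h2 : exp n ≤ exp ((2 * (n : ℝ) + 1) * π) + 1 := by
    have : (n : ℝ) ≤ (2 * (n : ℝ) + 1) * π := by
      have : (0 : ℝ) ≤ n := n.cast_nonneg
      nlinarith [pi_gt_three]
    linarith [exp_le_exp.mpr this]
  rw [div_div, ← exp_nat_mul, show (n : ℝ) * -1 = -n by ring, exp_neg, ← one_div]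
  exact one_div_le_one_div_of_le (exp_pos _) (by nlinarith [exp_pos (n : ℝ)])

theorem riemannZeta_sub_tsum_odd_pow_div_exp (m : ℕ) :
    riemannZeta (4 * (m : ℂ) + 3) -
        ((2 / (1 - 1 / (2 : ℝ) ^ (4 * m + 3)) *
          ∑' n : ℕ, 1 / (2 * (n : ℝ) + 1) ^ (4 * m + 3) /
            (exp ((2 * (n : ℝ) + 1) * π) + 1) : ℝ) : ℂ) =
      ((-((2 : ℝ) ^ (4 * m + 2) * π ^ (4 * m + 3) / ((2 : ℝ) ^ (4 * m + 3) - 1)) *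
          ∑ j ∈ Finset.Icc 1 (2 * m + 1),
            (-1 : ℝ) ^ j * (bernoulli (2 * j) : ℝ) * (bernoulli (4 * m + 4 - 2 * j) : ℝ) /
                ((Nat.factorial (2 * j) : ℝ) * (Nat.factorial (4 * m + 4 - 2 * j) : ℝ)) *
              ((2 : ℝ) ^ (2 * j) - 1) * ((2 : ℝ) ^ (4 * m + 4 - 2 * j) - 1) : ℝ) : ℂ) := by
  have hz : HasSum (fun n : ℕ => 1 / (n : ℝ) ^ (4 * m + 3)) (∑' n : ℕ, 1 / (n : ℝ) ^ (4 * m + 3)) :=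
    (summable_one_div_nat_pow.mpr (by omega)).hasSum
  have hzeta : riemannZeta (4 * (m : ℂ) + 3) = ((∑' n : ℕ, 1 / (n : ℝ) ^ (4 * m + 3) : ℝ) : ℂ) := by
    have := zeta_nat_eq_tsum_of_gt_one (k := 4 * m + 3) (by omega)
    push_cast at this ⊢
    exact this
  -- The tanh series is evaluated a second time, by splitting `1 - 2 / (exp + 1)`.
  have h1 := (hasSum_one_div_odd_pow hz).sub ((summable_odd_pow_div_exp (4 * m + 3)).hasSum.mul_left 2)
  have h2 := (hasSum_tanh_div_odd_pow_bernoulli m).unique (h1.congr_fun fun n => by field_simp)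
  rw [hzeta, ← Complex.ofReal_sub, Complex.ofReal_inj]
  generalize (∑ j ∈ Finset.Icc 1 (2 * m + 1), _ : ℝ) = S at h2 ⊢
  set Z := ∑' n : ℕ, 1 / (n : ℝ) ^ (4 * m + 3)
  generalize (∑' n : ℕ, _ : ℝ) = T at h2 ⊢
  have hP : (1 : ℝ) < 2 ^ (4 * m + 3) := one_lt_pow₀ one_lt_two (by omega)
  rw [pow_succ (2 : ℝ) (4 * m + 2)] at h2 hP ⊢
  have hP1 : (2 : ℝ) ^ (4 * m + 2) * 2 - 1 ≠ 0 := by linarith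
  have hP2 : 1 - 1 / ((2 : ℝ) ^ (4 * m + 2) * 2) =
    ((2 : ℝ) ^ (4 * m + 2) * 2 - 1) / ((2 : ℝ) ^ (4 * m + 2) * 2) := by field_simp
  rw [hP2] at h2 ⊢
  generalize (2 : ℝ) ^ (4 * m + 2) = P at *
  have hP3 : P ≠ 0 := by linarith
  have hP4 : 2 * P - 1 ≠ 0 := by linarith
  field_simp at h2 ⊢
  linear_combination -h2

theorem odd_zpow_div_exp_eq (s : ℕ) (t : ℤ) (ht : t = -s) (n : ℕ) :
    (2 * ((n + 1 : ℕ) : ℝ) - 1) ^ t / (exp ((2 * ((n + 1 : ℕ) : ℝ) - 1) * π) + 1) =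
      1 / (2 * (n : ℝ) + 1) ^ s / (exp ((2 * (n : ℝ) + 1) * π) + 1) := by
  rw [show 2 * ((n + 1 : ℕ) : ℝ) - 1 = 2 * (n : ℝ) + 1 by push_cast; ring, ht, zpow_neg,
    zpow_natCast, one_div]

theorem tsum_pnat_odd_zpow_div_exp (s : ℕ) (t : ℤ) (ht : t = -s) :
    ∑' j : ℕ+, (2 * (j : ℝ) - 1) ^ t / (exp ((2 * (j : ℝ) - 1) * π) + 1) =
      ∑' n : ℕ, 1 / (2 * (n : ℝ) + 1) ^ s / (exp ((2 * (n : ℝ) + 1) * π) + 1) := by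
  rw [tsum_pnat_eq_tsum_succ
    (f := fun n : ℕ => (2 * (n : ℝ) - 1) ^ t / (exp ((2 * (n : ℝ) - 1) * π) + 1))]
  exact tsum_congr (odd_zpow_div_exp_eq s t ht)

theorem corollary4p3 :
    (∀ m : ℕ,
      Summable (fun j : ℕ+ =>
        (2 * (j : ℝ) - 1) ^ (-4 * (m : ℤ) - 3) / (Real.exp ((2 * (j : ℝ) - 1) * Real.pi) + 1)) ∧
      riemannZeta (4 * (m : ℂ) + 3) -
          ((2 / (1 - (2 : ℝ) ^ (-4 * (m : ℤ) - 3)) *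
            ∑' j : ℕ+, (2 * (j : ℝ) - 1) ^ (-4 * (m : ℤ) - 3) /
              (Real.exp ((2 * (j : ℝ) - 1) * Real.pi) + 1) : ℝ) : ℂ) =
        ((-((2 : ℝ) ^ (4 * m + 2) * Real.pi ^ (4 * m + 3) / ((2 : ℝ) ^ (4 * m + 3) - 1)) *
            ∑ j ∈ Finset.Icc 1 (2 * m + 1),
              (-1 : ℝ) ^ j * (bernoulli (2 * j) : ℝ) * (bernoulli (4 * m + 4 - 2 * j) : ℝ) /
                  ((Nat.factorial (2 * j) : ℝ) * (Nat.factorial (4 * m + 4 - 2 * j) : ℝ)) *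
                ((2 : ℝ) ^ (2 * j) - 1) * ((2 : ℝ) ^ (4 * m + 4 - 2 * j) - 1) : ℝ) : ℂ)) ∧
    riemannZeta 3 -
        ((16 / 7 * ∑' j : ℕ+, (2 * (j : ℝ) - 1) ^ (-3 : ℤ) /
          (Real.exp ((2 * (j : ℝ) - 1) * Real.pi) + 1) : ℝ) : ℂ) =
      ((Real.pi ^ 3 / 28 : ℝ) : ℂ) := by

  have main := fun m : ℕ => riemannZeta_sub_tsum_odd_pow_div_exp m
  refine ⟨fun m => ⟨?_, ?_⟩, ?_⟩
  · rw [summable_pnat_iff_summable_succ (f := fun n : ℕ => (2 * (n : ℝ) - 1) ^ (-4 * (m : ℤ) - 3) /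
      (Real.exp ((2 * (n : ℝ) - 1) * Real.pi) + 1))]
    exact (summable_odd_pow_div_exp (4 * m + 3)).congr fun n =>
      (odd_zpow_div_exp_eq (4 * m + 3) _ (by push_cast; ring) n).symm
  · rw [tsum_pnat_odd_zpow_div_exp (4 * m + 3) _ (by push_cast; ring), ← main m,
      show -4 * (m : ℤ) - 3 = -((4 * m + 3 : ℕ) : ℤ) by push_cast; ring, zpow_neg, zpow_natCast,
      one_div]
  · rw [tsum_pnat_odd_zpow_div_exp 3 (-3) rfl]
    have h := main 0
    -- For `m = 0` only `j = 1` occurs, with both Bernoulli factors equal to `1 / 6`.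
    norm_num [Nat.factorial, bernoulli_two] at h ⊢
    rw [h]
    ring
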